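/- For $d\ge 1$ let $\mathfrak{D}_d\subseteq\mathbb{Z}^{d\times d}$ be the set of all diagonal integer $d\times d$ matrices. A $d$-dimensional integer register machine over $\mathfrak{D}_d$ consists of a finite set $Q$ of control states, a finite alphabet $\Sigma$, a set of transitions $\Delta\subseteq Q\times\Sigma\times Q$, and for each $a\in\Sigma$ an affine map $\tau(a):\mathbb{Z}^d\to\mathbb{Z}^d$, $\tau(a)(v)=A_a v+b_a$, with $A_a\in\mathfrak{D}_d$ and $b_a\in\mathbb{Z}^d$. Its configurations are the pairs $(q,v)\in Q\times\mathbb{Z}^d$, and there is a step from $(q,v)$ to $(q',v')$ if there is some $a\in\Sigma$ with $(q,a,q')\in\Delta$ and $v'=\tau(a)(v)$; a run is a finite, possibly empty, sequence of steps. The coverability problem for integer register machines over $\mathfrak{D}_d$ asks, given such a machine and configurations $(q,v)$ and $(q',v')$ of it, whether there is some $z\in\mathbb{Z}^d$ with $z\ge v'$ componentwise and a run from $(q,v)$ to $(q',z)$. Then coverability for integer register machines over $\mathfrak{D}_d$ is undecidable already for $d=4$, that is, for every $d\ge 4$ (in particular for $d=4$) there is no algorithm that decides this problem. -/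

import Mathlib

/-- A dimension-`d` integer register machine over a set `𝔄` of integer `d × d` matrices, with
finite set `Q` of control states and finite alphabet `S`. -/
structure IntegerRegisterMachine {d : ℕ} (𝔄 : Set (Matrix (Fin d) (Fin d) ℤ))
    (Q S : Type) [Finite Q] [Finite S] where
  /-- the finite set of transitions -/
  Δ : Set (Q × S × Q)
  /-- the transformation attached to each letter -/
  τ : S → (Fin d → ℤ) → (Fin d → ℤ)
  /-- each `τ a` is affine with linear part in `𝔄` -/
  affine : ∀ a, ∃ A ∈ 𝔄, ∃ b : Fin d → ℤ, ∀ v, τ a v = A.mulVec v + b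

namespace IntegerRegisterMachine

variable {d : ℕ} {𝔄 : Set (Matrix (Fin d) (Fin d) ℤ)} {Q S : Type} [Finite Q] [Finite S]

/-- One-step relation on configurations `q(v)`, i.e. pairs `(q, v)`, labelled by a letter. -/
def StepOn (M : IntegerRegisterMachine 𝔄 Q S) (a : S) (c c' : Q × (Fin d → ℤ)) : Prop :=
  (c.1, a, c'.1) ∈ M.Δ ∧ c'.2 = M.τ a c.2

/-- One-step relation, for some letter. -/
def Step (M : IntegerRegisterMachine 𝔄 Q S) (c c' : Q × (Fin d → ℤ)) : Prop :=
  ∃ a, M.StepOn a c c'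

/-- There is a (possibly empty) finite run from `c` to `c'`. -/
def Reaches (M : IntegerRegisterMachine 𝔄 Q S) (c c' : Q × (Fin d → ℤ)) : Prop :=
  Relation.ReflTransGen M.Step c c'

/-- From `c`, the machine reaches a configuration with the control state of `c'` and with
register values that are componentwise at least those of `c'`. -/
def Covers (M : IntegerRegisterMachine 𝔄 Q S) (c c' : Q × (Fin d → ℤ)) : Prop :=
  ∃ z : Fin d → ℤ, M.Reaches c (c'.1, z) ∧ ∀ i, c'.2 i ≤ z i

end IntegerRegisterMachine

/-- Finite data describing a dimension-`d` machine: the number `n` of states (the states are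
`0, …, n - 1`); the list of the pairs `(A, b)` describing `v ↦ A v + b` for the letters
`0, 1, …`; the list of the transitions `(q, a, q')`. -/
abbrev MachineCode (d : ℕ) : Type :=
  ℕ × List ((Fin d → Fin d → ℤ) × (Fin d → ℤ)) × List (ℕ × ℕ × ℕ)

namespace MachineCode

variable {d : ℕ}

def numStates (c : MachineCode d) : ℕ := c.1

def letters (c : MachineCode d) : List ((Fin d → Fin d → ℤ) × (Fin d → ℤ)) := c.2.1

def transitions (c : MachineCode d) : List (ℕ × ℕ × ℕ) := c.2.2

/-- The data describe a machine over `𝔄`: transitions use existing states and letters only, and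
all matrices lie in `𝔄`. -/
structure Valid (𝔄 : Set (Matrix (Fin d) (Fin d) ℤ)) (c : MachineCode d) : Prop where
  transitions_lt : ∀ t ∈ c.transitions,
    t.1 < c.numStates ∧ t.2.1 < c.letters.length ∧ t.2.2 < c.numStates
  matrix_mem : ∀ l ∈ c.letters, Matrix.of l.1 ∈ 𝔄

/-- The machine described by valid data. -/
def toMachine {𝔄 : Set (Matrix (Fin d) (Fin d) ℤ)} (c : MachineCode d) (h : c.Valid 𝔄) :
    IntegerRegisterMachine 𝔄 (Fin c.numStates) (Fin c.letters.length) where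
  Δ := {t | ((t.1 : ℕ), (t.2.1 : ℕ), (t.2.2 : ℕ)) ∈ c.transitions}
  τ a v := (Matrix.of (c.letters.get a).1).mulVec v + (c.letters.get a).2
  affine a := ⟨Matrix.of (c.letters.get a).1, h.matrix_mem _ (List.get_mem _ _),
    (c.letters.get a).2, fun _ => rfl⟩

end MachineCode

/-- Finite data for an instance of the coverability problem: a machine and two configurations. -/
abbrev CoverabilityInput (d : ℕ) : Type :=
  MachineCode d × (ℕ × (Fin d → ℤ)) × (ℕ × (Fin d → ℤ))

/-- Coverability for integer register machines over `𝔄` is decidable: some algorithm (a partial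
computable function) halts with the correct answer on every instance, that is, given a machine
over `𝔄` and configurations `q(v)` and `q'(v')` of it. Nothing is asked of the algorithm on
inputs that are not instances. -/
def CoverabilityDecidable {d : ℕ} (𝔄 : Set (Matrix (Fin d) (Fin d) ℤ)) : Prop :=
  ∃ f : CoverabilityInput d →. Bool, Partrec f ∧
    ∀ (c : MachineCode d) (h : c.Valid 𝔄) (q q' : Fin c.numStates) (v v' : Fin d → ℤ),
      ∃ b ∈ f (c, ((q : ℕ), v), ((q' : ℕ), v')),
        (b = true ↔ (c.toMachine h).Covers (q, v) (q', v'))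

/-- The set of all diagonal integer `d × d` matrices. -/
def diagonalMatrices (d : ℕ) : Set (Matrix (Fin d) (Fin d) ℤ) := {A | A.IsDiag}

/-! The halting problem reduces to coverability for one fixed machine with varying initial
registers. A word over a finite alphabet is stored as a number in base `b` with nonzero digits. This
is injective, and appending `u` multiplies the value by `b ^ u.length` and adds the value of `u`.
Diagonal affine maps can therefore append words to two tapes X and Y. Their values x and y are kept
in four registers as x, -x, y, -y. A loop at the last state turns these into x-n, n-x, y-n, n-y,
which are all nonnegative only if x = n = y. Covering the zero vector thus tests X = Y
(`wordSystem_reach_iff`).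

As in Post's correspondence problem, this equality checks a computation C₀, ..., Cₖ = D: the first
tape receives C₀, ..., Cₖ₋₁ and finally D, while the second starts with C₀ and receives C₁, ..., Cₖ
(`ruleSystem_reach_iff`). Stack machines are deterministic systems of such rewritings
(`blockStep_stackBlocks_iff`), and `TM2` machines, which evaluate partial recursive functions, are
stack machines (`reaches_iff_blockStep`). Inputs are powers of two: their encodings differ only in
the length of a run of one symbol, so the initial registers are easily seen to be computable. -/

open Relation

/-! ### Diagonal affine systems as machine codes -/

section AffineSystems

variable {d : ℕ} {Q : Type}

/-- The diagonal affine map `v ↦ l.1 * v + l.2` (componentwise). -/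
def diagAct (l : (Fin d → ℤ) × (Fin d → ℤ)) (v : Fin d → ℤ) : Fin d → ℤ :=
  fun i => l.1 i * v i + l.2 i

/-- One step of the register system with edge set `E`. -/
def AffStep (E : Set (Q × ((Fin d → ℤ) × (Fin d → ℤ)) × Q)) (c c' : Q × (Fin d → ℤ)) : Prop :=
  ∃ l, (c.1, l, c'.1) ∈ E ∧ c'.2 = diagAct l c.2

theorem mulVec_of_ite_diag (a v : Fin d → ℤ) :
    (Matrix.of fun i j => if i = j then a i else 0).mulVec v = fun i => a i * v i := by
  funext i
  simp [Matrix.mulVec, dotProduct]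

/-- A finite system of diagonal affine edges over a countable state set is described by a valid
machine code. -/
theorem exists_machineCode [Countable Q] {E : Set (Q × ((Fin d → ℤ) × (Fin d → ℤ)) × Q)}
    (hE : E.Finite) (s t : Q) :
    ∃ (c : MachineCode d) (hc : c.Valid (diagonalMatrices d)) (qs qt : Fin c.numStates),
      ∀ v v', (c.toMachine hc).Covers (qs, v) (qt, v') ↔
        ∃ z, ReflTransGen (AffStep E) (s, v) (t, z) ∧ ∀ i, v' i ≤ z i := by
  classical
  obtain ⟨g, hg⟩ := exists_injective_nat Q
  obtain ⟨L, hL⟩ : ∃ L : List (Q × ((Fin d → ℤ) × (Fin d → ℤ)) × Q), ∀ e, e ∈ L ↔ e ∈ E :=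
    ⟨hE.toFinset.toList, by simp⟩
  obtain ⟨N, hsN, htN, hN⟩ : ∃ N, g s < N ∧ g t < N ∧ ∀ e ∈ L, g e.1 < N ∧ g e.2.2 < N := by
    -- The image of `g` need not be an initial segment of ℕ; `N` only has to exceed the finitely
    -- many numbers in use, and a sum does.
    refine ⟨(L.map fun e => g e.1 + g e.2.2).sum + g s + g t + 1, by omega, by omega, ?_⟩
    intro e he
    have := List.single_le_sum (l := L.map fun e => g e.1 + g e.2.2) (by simp) _
      (List.mem_map_of_mem he)
    omega
  -- Each edge gets its own letter, namely its index in `L`.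
  let c : MachineCode d := (N,
    L.map (fun e => ((fun i j => if i = j then e.2.1.1 i else 0), e.2.1.2)),
    List.ofFn fun i : Fin L.length => (g (L.get i).1, (i : ℕ), g (L.get i).2.2))
  have hc : c.Valid (diagonalMatrices d) := by
    constructor
    · intro t ht
      obtain ⟨i, rfl⟩ := (List.mem_ofFn' _ _).1 ht
      refine ⟨(hN _ (List.get_mem _ _)).1, ?_, (hN _ (List.get_mem _ _)).2⟩
      simp [c, MachineCode.letters]
    · intro l hl
      obtain ⟨e, -, rfl⟩ := List.mem_map.1 hl
      intro i j hij
      simp [hij]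
  have hstep : ∀ x y : Fin N × (Fin d → ℤ), (c.toMachine hc).Step x y ↔
      ∃ q l q', (q, l, q') ∈ E ∧ (x.1 : ℕ) = g q ∧ (y.1 : ℕ) = g q' ∧ y.2 = diagAct l x.2 := by
    intro x y
    constructor
    · rintro ⟨a, ha, hy⟩
      obtain ⟨i, hi⟩ := (List.mem_ofFn' _ _).1 (show ((x.1 : ℕ), (a : ℕ), (y.1 : ℕ)) ∈ _ from ha)
      simp only [Prod.mk.injEq] at hi
      obtain ⟨h1, h2, h3⟩ := hi
      refine ⟨(L.get i).1, (L.get i).2.1, (L.get i).2.2, (hL _).1 (List.get_mem _ _), h1.symm,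
        h3.symm, ?_⟩
      rw [hy]
      simp only [MachineCode.toMachine, MachineCode.letters, c, List.get_eq_getElem,
        List.getElem_map, mulVec_of_ite_diag]
      simp only [← h2]
      rfl
    · rintro ⟨q, l, q', he, h1, h2, h3⟩
      obtain ⟨i, hi⟩ := List.mem_iff_get.1 ((hL _).2 he)
      refine ⟨⟨i, by simp [c, MachineCode.letters]⟩, ?_, ?_⟩
      · refine (List.mem_ofFn' _ _).2 ⟨i, ?_⟩
        simp only [hi, h1, h2]
      · rw [h3]
        simp only [MachineCode.toMachine, MachineCode.letters, c, List.get_eq_getElem,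
          List.getElem_map, mulVec_of_ite_diag]
        rw [List.get_eq_getElem] at hi
        rw [hi]
        rfl
  refine ⟨c, hc, ⟨g s, hsN⟩, ⟨g t, htN⟩, fun v v' => ?_⟩
  have fwd : ∀ x y, ReflTransGen (c.toMachine hc).Step x y → ∀ q, (x.1 : ℕ) = g q →
      ∃ q', (y.1 : ℕ) = g q' ∧ ReflTransGen (AffStep E) (q, x.2) (q', y.2) := by
    intro x y h q hq
    induction h with
    | refl => exact ⟨q, hq, .refl⟩
    | tail _ h ih =>
      obtain ⟨q₁, h1, h2⟩ := ih
      obtain ⟨p, l, p', he, h3, h4, h5⟩ := (hstep _ _).1 h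
      obtain rfl := hg (h1.symm.trans h3)
      exact ⟨p', h4, h2.tail ⟨l, he, h5⟩⟩
  have bwd : ∀ x y, ReflTransGen (AffStep E) x y → ∀ (hx : g x.1 < N),
      ∃ hy : g y.1 < N, ReflTransGen (c.toMachine hc).Step (⟨g x.1, hx⟩, x.2) (⟨g y.1, hy⟩, y.2) := by
    intro x y h hx
    induction h with
    | refl => exact ⟨hx, .refl⟩
    | tail _ h ih =>
      obtain ⟨h1, h2⟩ := ih
      obtain ⟨l, he, h3⟩ := h
      exact ⟨(hN _ ((hL _).2 he)).2, h2.tail ((hstep _ _).2 ⟨_, l, _, he, rfl, rfl, h3⟩)⟩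
  constructor
  · rintro ⟨z, hz, hle⟩
    obtain ⟨q', h1, h2⟩ := fwd _ _ hz s rfl
    obtain rfl := hg (show g t = g q' from h1)
    exact ⟨z, h2, hle⟩
  · rintro ⟨z, hz, hle⟩
    obtain ⟨_, h⟩ := bwd _ _ hz hsN
    exact ⟨z, h, hle⟩

end AffineSystems

/-! ### Two tapes in four registers -/

section WordSystems

variable {A Q : Type}

/-- Value of a word in base `b`, with digit values given by `code`. -/
def wordVal (code : A → ℕ) (b : ℕ) (w : List A) : ℕ :=
  w.foldl (fun n a => n * b + code a) 0

theorem foldl_eq_wordVal (code : A → ℕ) (b : ℕ) (w : List A) (n : ℕ) :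
    w.foldl (fun n a => n * b + code a) n = n * b ^ w.length + wordVal code b w := by
  induction w using List.reverseRecOn with
  | nil => simp [wordVal]
  | append_singleton w a ih =>
    simp only [wordVal, List.foldl_append, List.foldl_cons, List.foldl_nil, List.length_append,
      List.length_cons, List.length_nil] at ih ⊢
    rw [ih]
    ring

theorem wordVal_append (code : A → ℕ) (b : ℕ) (u w : List A) :
    wordVal code b (u ++ w) = wordVal code b u * b ^ w.length + wordVal code b w := by
  rw [← foldl_eq_wordVal, wordVal, List.foldl_append, ← wordVal]

/-- The last digit is the residue modulo `b`, the rest the quotient. Since no digit is zero, the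
length of the word need not be recorded. -/
theorem wordVal_injective {code : A → ℕ} {b : ℕ} (hc : Function.Injective code)
    (hpos : ∀ a, 0 < code a) (hlt : ∀ a, code a < b) : Function.Injective (wordVal code b) := by
  have hval : ∀ (u : List A) a, wordVal code b (u ++ [a]) = wordVal code b u * b + code a := by
    intro u a
    simp [wordVal]
  intro u
  induction u using List.reverseRecOn with
  | nil =>
    intro w h
    rcases List.eq_nil_or_concat' w with rfl | ⟨w, a, rfl⟩
    · rfl
    · have := hpos a
      rw [hval] at h
      simp only [wordVal, List.foldl_nil] at h
      omega
  | append_singleton u a ih =>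
    intro w h
    rcases List.eq_nil_or_concat' w with rfl | ⟨w, a', rfl⟩
    · have := hpos a
      rw [hval] at h
      simp only [wordVal, List.foldl_nil] at h
      omega
    · rw [hval, hval] at h
      have h1 : code a = code a' := by
        have := congrArg (· % b) h
        simpa [Nat.add_mod, Nat.mod_eq_of_lt (hlt _)] using this
      rw [h1] at h
      have hb : 0 < b := (hpos a).trans (hlt a)
      have h2 := ih (Nat.eq_of_mul_eq_mul_right hb (Nat.add_right_cancel h))
      rw [h2, hc h1]

/-- One step of the system that appends words to two tapes. -/
def WordStep (W : Set (Q × (List A × List A) × Q)) (c c' : Q × List A × List A) : Prop :=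
  ∃ u v, (c.1, (u, v), c'.1) ∈ W ∧ c'.2.1 = c.2.1 ++ u ∧ c'.2.2 = c.2.2 ++ v

variable {d : ℕ}

/-- The sign with which register `i` stores its word. -/
def regSign (i : Fin d) : ℤ := if (i : ℕ) = 0 ∨ (i : ℕ) = 2 then 1 else -1

/-- The word that register `i` stores. -/
def regWord (i : Fin d) (X Y : List A) : List A := if (i : ℕ) < 2 then X else Y

/-- The register contents storing the words `X` and `Y`. -/
def wordRegs (d : ℕ) (code : A → ℕ) (b : ℕ) (X Y : List A) : Fin d → ℤ :=
  fun i => regSign i * wordVal code b (regWord i X Y)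

/-- The diagonal affine edges simulating a two-tape word system, with a new initial state that
fixes the signs, and a new final state that decreases the absolute values of all registers. -/
inductive WordEdge (d : ℕ) (code : A → ℕ) (b : ℕ) (W : Set (Q × (List A × List A) × Q))
    (s t : Q) : (Q ⊕ Bool) × ((Fin d → ℤ) × (Fin d → ℤ)) × (Q ⊕ Bool) → Prop
  | start : WordEdge d code b W s t (.inr false, (regSign, 0), .inl s)
  | step {q u v q'} : (q, (u, v), q') ∈ W → WordEdge d code b W s t
      (.inl q, (fun i => (b : ℤ) ^ (regWord i u v).length, wordRegs d code b u v), .inl q')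
  | final : WordEdge d code b W s t (.inl t, (1, 0), .inr true)
  | decrease : WordEdge d code b W s t (.inr true, (1, fun i => - regSign i), .inr true)

theorem finite_wordEdge (d : ℕ) (code : A → ℕ) (b : ℕ) {W : Set (Q × (List A × List A) × Q)}
    (hW : W.Finite) (s t : Q) : {e | WordEdge d code b W s t e}.Finite := by
  refine Set.Finite.subset (((hW.image fun e =>
    ((.inl e.1, (fun i => (b : ℤ) ^ (regWord i e.2.1.1 e.2.1.2).length,
      wordRegs d code b e.2.1.1 e.2.1.2), .inl e.2.2) :
      (Q ⊕ Bool) × ((Fin d → ℤ) × (Fin d → ℤ)) × (Q ⊕ Bool))).union (Set.finite_singleton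
    (.inr false, (regSign, 0), .inl s))).union ((Set.finite_singleton
    (.inl t, (1, 0), .inr true)).union (Set.finite_singleton
    (.inr true, (1, fun i => - regSign i), .inr true)))) ?_
  rintro e (_ | h | _ | _)
  · exact .inl (.inr rfl)
  · exact .inl (.inl ⟨_, h, rfl⟩)
  · exact .inr (.inl rfl)
  · exact .inr (.inr rfl)

theorem regWord_append (i : Fin d) (X Y u v : List A) :
    regWord i (X ++ u) (Y ++ v) = regWord i X Y ++ regWord i u v := by
  unfold regWord
  split_ifs <;> rfl

theorem diagAct_wordRegs (code : A → ℕ) (b : ℕ) (X Y u v : List A) :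
    diagAct (fun i => (b : ℤ) ^ (regWord i u v).length, wordRegs d code b u v)
      (wordRegs d code b X Y) = wordRegs d code b (X ++ u) (Y ++ v) := by
  funext i
  simp only [diagAct, wordRegs, regWord_append, wordVal_append]
  push_cast
  ring

/-- Registers 0 to 3 hold the two words with both signs. Any further register behaves like register
3 and adds no condition. -/
theorem wordSystem_reach_iff {code : A → ℕ} {b : ℕ} (hc : Function.Injective code)
    (hpos : ∀ a, 0 < code a) (hlt : ∀ a, code a < b) (hd : 4 ≤ d)
    (W : Set (Q × (List A × List A) × Q)) (s t : Q) (Y₀ : List A) :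
    (∃ z, ReflTransGen (AffStep {e | WordEdge d code b W s t e})
        (.inr false, fun i => (wordVal code b (regWord i [] Y₀) : ℤ)) (.inr true, z) ∧
        ∀ i, 0 ≤ z i) ↔
      ∃ X, ReflTransGen (WordStep W) (s, [], Y₀) (t, X, X) := by
  constructor
  · rintro ⟨z, hz, hle⟩
    -- A run has three phases: before the signs are set, simulation of the word system, and `n`
    -- rounds of the final loop.
    have key : ∀ c, ReflTransGen (AffStep {e | WordEdge d code b W s t e})
        (.inr false, fun i => (wordVal code b (regWord i [] Y₀) : ℤ)) c →
        (c = (.inr false, fun i => (wordVal code b (regWord i [] Y₀) : ℤ))) ∨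
        (∃ q X Y, ReflTransGen (WordStep W) (s, [], Y₀) (q, X, Y) ∧
          c = (.inl q, wordRegs d code b X Y)) ∨
        (∃ X Y, ∃ n : ℤ, ReflTransGen (WordStep W) (s, [], Y₀) (t, X, Y) ∧
          c = (.inr true, fun i => wordRegs d code b X Y i - n * regSign i)) := by
      intro c h
      induction h with
      | refl => exact .inl rfl
      | @tail c c' _ h ih =>
        obtain ⟨q', v'⟩ := c'
        obtain ⟨l, he, hv⟩ := h
        simp only [Set.mem_ofPred_eq] at he hv
        subst hv
        rcases ih with rfl | ⟨q, X, Y, hr, rfl⟩ | ⟨X, Y, n, hr, rfl⟩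
        · cases he
          refine .inr (.inl ⟨s, [], Y₀, .refl, ?_⟩)
          congr 1
          funext i
          simp [diagAct, wordRegs]
        · cases he with
          | step hW => exact .inr (.inl ⟨_, _, _, hr.tail ⟨_, _, hW, rfl, rfl⟩,
              by rw [diagAct_wordRegs]⟩)
          | final => exact .inr (.inr ⟨X, Y, 0, hr, by congr 1; funext i; simp [diagAct]⟩)
        · cases he
          refine .inr (.inr ⟨X, Y, n + 1, hr, ?_⟩)
          congr 1
          funext i
          simp only [diagAct, Pi.one_apply]
          ring
    rcases key _ hz with h | ⟨q, X, Y, hr, h⟩ | ⟨X, Y, n, hr, h⟩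
    · cases h
    · cases h
    · obtain rfl : z = _ := (Prod.mk.inj h).2
      -- The four inequalities say that both word values are equal to `n`.
      have h0 := hle ⟨0, by omega⟩
      have h1 := hle ⟨1, by omega⟩
      have h2 := hle ⟨2, by omega⟩
      have h3 := hle ⟨3, by omega⟩
      simp [wordRegs, regSign, regWord] at h0 h1 h2 h3
      have : wordVal code b X = wordVal code b Y := by omega
      obtain rfl := wordVal_injective hc hpos hlt this
      exact ⟨X, hr⟩
  · rintro ⟨X, h⟩
    have h1 : ReflTransGen (AffStep {e | WordEdge d code b W s t e})
        (.inl s, wordRegs d code b [] Y₀) (.inl t, wordRegs d code b X X) := by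
      refine ReflTransGen.lift (r := WordStep W) (fun c : Q × List A × List A =>
        ((.inl c.1, wordRegs d code b c.2.1 c.2.2) : (Q ⊕ Bool) × (Fin d → ℤ))) ?_ _ _ h
      rintro ⟨q, X, Y⟩ ⟨q', X', Y'⟩ ⟨u, v, hW, hX, hY⟩
      simp only at hX hY hW
      subst hX hY
      exact ⟨_, WordEdge.step hW, (diagAct_wordRegs ..).symm⟩
    have h2 : ∀ n : ℕ, ReflTransGen (AffStep {e | WordEdge d code b W s t e})
        (.inl t, wordRegs d code b X X)
        (.inr true, fun i => wordRegs d code b X X i - n * regSign i) := by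
      intro n
      induction n with
      | zero => exact .single ⟨_, WordEdge.final, by funext i; simp [diagAct]⟩
      | succ n ih =>
        refine ih.tail ⟨_, WordEdge.decrease, ?_⟩
        funext i
        simp only [diagAct, Pi.one_apply]
        push_cast
        ring
    -- With as many rounds as the common value, every register ends at 0.
    refine ⟨_, (ReflTransGen.head ⟨_, WordEdge.start, ?_⟩ h1).trans (h2 (wordVal code b X)), ?_⟩
    · intro i
      simp [wordRegs, regWord]
      ring_nf
      rfl
    · funext i
      simp [diagAct, wordRegs]

end WordSystems

/-! ### Block rewriting by comparing two tapes -/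

section BlockRewriting

variable {B : Type}

/-- Blockwise suffix rewriting: `Rewrites r U V` means that `U` and `V` have as many blocks as `r`,
and each block `w ++ α` of `U` is replaced by the block `w ++ β` in `V`, where `(α, β)` is the
corresponding entry of `r`. -/
inductive Rewrites : List (List B × List B) → List (List B) → List (List B) → Prop
  | nil : Rewrites [] [] []
  | cons {α β r U V} (w : List B) : Rewrites r U V →
      Rewrites ((α, β) :: r) ((w ++ α) :: U) ((w ++ β) :: V)

theorem Rewrites.length {r : List (List B × List B)} {U V} (h : Rewrites r U V) :
    U.length = r.length ∧ V.length = r.length := by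
  induction h with
  | nil => simp
  | cons _ _ ih => simp [ih]

/-- One step of a system of blockwise suffix rewriting rules. -/
def BlockStep (R : Set (List (List B × List B))) (U V : List (List B)) : Prop :=
  ∃ r ∈ R, Rewrites r U V

/-- A word with a terminator appended. -/
def terminated (w : List B) : List (Option B) := w.map some ++ [none]

/-- A list of blocks as a single word, each block being followed by a terminator. -/
def blockWord (U : List (List B)) : List (Option B) := U.flatMap terminated

theorem blockWord_append (U V : List (List B)) :
    blockWord (U ++ V) = blockWord U ++ blockWord V := List.flatMap_append

theorem blockWord_cons (w : List B) (V : List (List B)) :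
    blockWord (w :: V) = w.map some ++ none :: blockWord V := by
  simp [blockWord, terminated]

/-- The letters of a block are never `none`, so the first `none` ends the first block. -/
theorem blockWord_injective : Function.Injective (blockWord : List (List B) → _) := by
  have key : ∀ (u v : List B) (x y : List (Option B)),
      u.map some ++ none :: x = v.map some ++ none :: y → u = v ∧ x = y := by
    intro u
    induction u with
    | nil =>
      rintro (_ | ⟨b, v⟩) x y h <;> simp_all
    | cons a u ih =>
      rintro (_ | ⟨b, v⟩) x y h
      · simp at h
      · simp only [List.map_cons, List.cons_append, List.cons.injEq, Option.some.injEq] at h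
        obtain ⟨rfl, rfl⟩ := ih _ _ _ h.2
        simp [h.1]
  intro U
  induction U with
  | nil =>
    rintro (_ | ⟨v, V⟩) h
    · rfl
    · rw [blockWord_cons] at h
      simp [blockWord] at h
  | cons u U ih =>
    rintro (_ | ⟨v, V⟩) h
    · rw [blockWord_cons] at h
      simp [blockWord] at h
    · rw [blockWord_cons, blockWord_cons] at h
      obtain ⟨rfl, h'⟩ := key _ _ _ _ h
      rw [ih h']

/-- The edges of a two-tape word system whose loops at the state `[]` append to both tapes the
left and the right hand side of a rewriting step. A state is the part of a rule that is still to be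
executed. The last rule of the system moves to the state `none` and completes the first tape. -/
inductive RuleEdge (R : Set (List (List B × List B))) (C : List (List B)) :
    Option (List (List B × List B)) × (List (Option B) × List (Option B)) ×
      Option (List (List B × List B)) → Prop
  | enter {r} : r ∈ R → RuleEdge R C (some [], ([], []), some r)
  | copy {r x q} (a : B) : r ∈ R → x :: q <:+ r →
      RuleEdge R C (some (x :: q), ([some a], [some a]), some (x :: q))
  | next {r α β q} : r ∈ R → (α, β) :: q <:+ r →
      RuleEdge R C (some ((α, β) :: q), (terminated α, terminated β), some q)
  | final : RuleEdge R C (some [], (blockWord C, []), none)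

theorem finite_ruleEdge [Finite B] {R : Set (List (List B × List B))} (hR : R.Finite)
    (C : List (List B)) : {e | RuleEdge R C e}.Finite := by
  have hS : {q | ∃ r ∈ R, q <:+ r}.Finite := by
    have : {q | ∃ r ∈ R, q <:+ r} = ⋃ r ∈ R, {q | q ∈ r.tails} := by
      ext q
      simp
    rw [this]
    exact hR.biUnion fun r _ => List.finite_toSet _
  refine Set.Finite.subset (((hR.image fun r =>
      ((some [], ([], []), some r) : Option (List (List B × List B)) ×
        (List (Option B) × List (Option B)) × Option (List (List B × List B)))).union
      ((hS.prod (Set.finite_univ (α := B))).image fun p =>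
        (some p.1, ([some p.2], [some p.2]), some p.1))).union
      ((hS.image fun q => (some q, (terminated (q.headD ([], [])).1,
        terminated (q.headD ([], [])).2), some q.tail)).union (Set.finite_singleton
      (some [], (blockWord C, []), none)))) ?_
  rintro e (h | ⟨a, h, h'⟩ | ⟨h, h'⟩ | _)
  · exact .inl (.inl ⟨_, h, rfl⟩)
  · exact .inl (.inr ⟨(_, a), ⟨⟨_, h, h'⟩, trivial⟩, rfl⟩)
  · exact .inr (.inl ⟨_, ⟨_, h, h'⟩, rfl⟩)
  · exact .inr (.inr rfl)

/-- The `copy` loop writes the unchanged prefix of a block on both tapes; `next` then writes the two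
suffixes with their terminators. -/
theorem wordStep_of_rewrites {R : Set (List (List B × List B))} {C : List (List B)}
    {r : List (List B × List B)} (hr : r ∈ R) {q : List (List B × List B)} {U V}
    (h : Rewrites q U V) (hq : q <:+ r) (X Y : List (Option B)) :
    ReflTransGen (WordStep {e | RuleEdge R C e}) (some q, X, Y)
      (some [], X ++ blockWord U, Y ++ blockWord V) := by
  induction h generalizing X Y with
  | nil => simpa [blockWord] using ReflTransGen.refl
  | @cons α β q U V w h ih =>
    induction w generalizing X Y with
    | nil =>
      refine ReflTransGen.head (b := (some q, X ++ terminated α, Y ++ terminated β))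
        ⟨_, _, RuleEdge.next hr hq, rfl, rfl⟩ ?_
      simpa [blockWord, terminated] using
        ih ((List.suffix_cons _ _).trans hq) (X ++ terminated α) (Y ++ terminated β)
    | cons a w ihw =>
      refine ReflTransGen.head (b := (some ((α, β) :: q), X ++ [some a], Y ++ [some a]))
        ⟨_, _, RuleEdge.copy a hr hq, rfl, rfl⟩ ?_
      simpa [blockWord, terminated] using ihw (X ++ [some a]) (Y ++ [some a])

/-- The run is read from its end: `U` and `V` come from the rest `q` of the current rule, `Us` and
`Vs` from the rules entered later. -/
theorem rewrites_of_wordStep {R : Set (List (List B × List B))} {C : List (List B)}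
    {c : Option (List (List B × List B)) × List (Option B) × List (Option B)} {X Y}
    (h : ReflTransGen (WordStep {e | RuleEdge R C e}) c (none, X, Y)) :
    ∀ q, c.1 = some q → ∃ U V Us Vs, Rewrites q U V ∧ List.Forall₂ (BlockStep R) Us Vs ∧
      X = c.2.1 ++ blockWord (U ++ Us.flatten ++ C) ∧ Y = c.2.2 ++ blockWord (V ++ Vs.flatten) := by
  induction h using ReflTransGen.head_induction_on with
  | refl => simp
  | @head c c' hs hr ih =>
    intro q hq
    obtain ⟨s, X₀, Y₀⟩ := c
    obtain ⟨s', X₁, Y₁⟩ := c'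
    obtain ⟨u, v, he, h1, h2⟩ := hs
    simp only [Set.mem_ofPred_eq] at he hq h1 h2
    subst h1 h2 hq
    cases he with
    | enter h =>
      obtain ⟨U, V, Us, Vs, h1, h2, h3, h4⟩ := ih _ rfl
      exact ⟨[], [], U :: Us, V :: Vs, .nil, .cons ⟨_, h, h1⟩ h2, by simpa using h3,
        by simpa using h4⟩
    | copy a h h' =>
      obtain ⟨U, V, Us, Vs, h1, h2, h3, h4⟩ := ih _ rfl
      cases h1 with
      | cons w h1 => exact ⟨_, _, Us, Vs, .cons (a :: w) h1, h2, by simpa [blockWord_cons] using h3,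
          by simpa [blockWord_cons] using h4⟩
    | next h h' =>
      obtain ⟨U, V, Us, Vs, h1, h2, h3, h4⟩ := ih _ rfl
      exact ⟨_, _, Us, Vs, .cons [] h1, h2, by simpa [blockWord_cons, terminated] using h3,
          by simpa [blockWord_cons, terminated] using h4⟩
    | final =>
      -- No edge leaves `none`, so the run stops here.
      rcases ReflTransGen.cases_head hr with h | ⟨c, ⟨u, v, hc, -⟩, -⟩
      · obtain ⟨-, h1, h2⟩ := Prod.mk.injEq _ _ _ _ ▸ h
        cases h
        exact ⟨[], [], [], [], .nil, .nil, by simp, by simp [blockWord]⟩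
      · cases hc

/-- All configurations have `m` blocks, so the two sides are aligned: the first left-hand side must
be `C`, and its right-hand side takes over the role of `C`. -/
theorem reach_of_flatten_eq {R : Set (List (List B × List B))} {m : ℕ}
    (hm : ∀ r ∈ R, r.length = m) {D : List (List B)} {Us Vs : List (List (List B))}
    (h : List.Forall₂ (BlockStep R) Us Vs) : ∀ C : List (List B), C.length = m →
      Us.flatten ++ D = C ++ Vs.flatten → ReflTransGen (BlockStep R) C D := by
  induction h with
  | nil =>
    intro C _ h
    simp only [List.flatten_nil, List.nil_append, List.append_nil] at h
    rw [h]
  | @cons U V Us Vs hUV _ ih =>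
    intro C hC h
    obtain ⟨r, hr, hrw⟩ := hUV
    simp only [List.flatten_cons, List.append_assoc] at h
    obtain ⟨rfl, h'⟩ := List.append_inj h (by rw [hrw.length.1, hm r hr, hC])
    exact .head ⟨r, hr, hrw⟩ (ih V (by rw [hrw.length.2, hm r hr]) h')

theorem ruleSystem_reach_iff {R : Set (List (List B × List B))} {m : ℕ}
    (hm : ∀ r ∈ R, r.length = m) {C : List (List B)} (hC : C.length = m) (D : List (List B)) :
    (∃ X, ReflTransGen (WordStep {e | RuleEdge R D e}) (some [], [], blockWord C) (none, X, X)) ↔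
      ReflTransGen (BlockStep R) C D := by
  constructor
  · rintro ⟨X, h⟩
    obtain ⟨U, V, Us, Vs, h1, h2, h3, h4⟩ := rewrites_of_wordStep h _ rfl
    cases h1
    simp only [List.nil_append] at h3 h4
    rw [h3, ← blockWord_append] at h4
    exact reach_of_flatten_eq hm h2 C hC (blockWord_injective h4)
  · intro h
    -- Invariant: the second tape is ahead of the first by exactly the current configuration.
    have key : ∀ X, ∃ X', ReflTransGen (WordStep {e | RuleEdge R D e})
        (some [], X, X ++ blockWord C) (some [], X', X' ++ blockWord D) := by
      clear hC
      induction h using ReflTransGen.head_induction_on with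
      | refl => exact fun X => ⟨X, .refl⟩
      | @head C C' hs _ ih =>
        intro X
        obtain ⟨r, hr, hrw⟩ := hs
        obtain ⟨X', hX'⟩ := ih (X ++ blockWord C)
        exact ⟨X', (ReflTransGen.head ⟨_, _, RuleEdge.enter hr, by simp, by simp⟩
          (wordStep_of_rewrites hr hrw (List.suffix_refl _) X (X ++ blockWord C))).trans hX'⟩
    obtain ⟨X, hX⟩ := key []
    exact ⟨X ++ blockWord D, hX.tail ⟨_, _, RuleEdge.final, rfl, by simp⟩⟩

end BlockRewriting

/-! ### Stack machines as block rewriting -/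

section StackMachines

variable {P K G : Type}

/-- One step of a multi-stack machine: in state `p` it looks at the top of the stack `key p`, moves
to a new state, and replaces that top symbol by a word. -/
def stackStep [DecidableEq K] (key : P → K) (nxt : P → Option G → P) (wr : P → Option G → List G)
    (c : P × (K → List G)) : P × (K → List G) :=
  (nxt c.1 (c.2 (key c.1)).head?,
    Function.update c.2 (key c.1) (wr c.1 (c.2 (key c.1)).head? ++ (c.2 (key c.1)).tail))

/-- A stack, with its top at the right end, above a bottom symbol. -/
def stackBlock (P : Type) {G : Type} (S : List G) : List (P ⊕ Option G) :=
  .inr none :: S.reverse.map (Sum.inr ∘ some)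

/-- A configuration of a multi-stack machine as a list of blocks. -/
def stackBlocks (ks : List K) (c : P × (K → List G)) : List (List (P ⊕ Option G)) :=
  [.inl c.1] :: ks.map fun k => stackBlock P (c.2 k)

/-- The replacement of the top symbol `g` of a stack, where `none` means that the stack is empty. -/
def topRule (P : Type) {G : Type} (g : Option G) (w : List G) :
    List (P ⊕ Option G) × List (P ⊕ Option G) :=
  ([.inr g], (g.elim [.inr none] fun _ => []) ++ w.reverse.map (Sum.inr ∘ some))

/-- The rewriting rule of a multi-stack machine for the state `p` and the top symbol `g`. -/
def stackRule [DecidableEq K] (key : P → K) (nxt : P → Option G → P) (wr : P → Option G → List G)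
    (ks : List K) (p : P) (g : Option G) : List (List (P ⊕ Option G) × List (P ⊕ Option G)) :=
  ([.inl p], [.inl (nxt p g)]) ::
    ks.map fun k => if k = key p then topRule P g (wr p g) else ([], [])

theorem rewrites_map {B : Type} {ks : List K} {r : K → List B × List B} {c d : K → List B}
    (h : ∀ k ∈ ks, ∃ w, c k = w ++ (r k).1 ∧ d k = w ++ (r k).2) :
    Rewrites (ks.map r) (ks.map c) (ks.map d) := by
  induction ks with
  | nil => exact .nil
  | cons k ks ih =>
    obtain ⟨w, h1, h2⟩ := h k (by simp)
    rw [List.map_cons, List.map_cons, List.map_cons, h1, h2]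
    exact .cons w (ih fun k hk => h k (by simp [hk]))

theorem Rewrites.of_map {B : Type} {ks : List K} {r : K → List B × List B} {c : K → List B} {V}
    (h : Rewrites (ks.map r) (ks.map c) V) : 
      List.Forall₂ (fun k v => ∃ w, c k = w ++ (r k).1 ∧ v = w ++ (r k).2) ks V := by
  induction ks generalizing V with
  | nil =>
    cases h
    exact .nil
  | cons k ks ih =>
    rw [List.map_cons, List.map_cons] at h
    generalize hr : r k = x at h
    generalize hc : c k = y at h
    cases h with
    | cons w h =>
      exact .cons ⟨w, by rw [hc, hr], by rw [hr]⟩ (ih h)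

/-- The bottom symbol acts as the top of an empty stack, so the last letter of a block always shows
`S.head?`; `topRule` puts the bottom symbol back. -/
theorem stackBlock_eq_append (S : List G) :
    ∃ w, stackBlock P S = w ++ [.inr S.head?] ∧ ∀ u : List G,
      stackBlock P (u ++ S.tail) = w ++ (topRule P S.head? u).2 := by
  rcases S with _ | ⟨a, S⟩
  · exact ⟨[], by simp [stackBlock], by simp [stackBlock, topRule]⟩
  · exact ⟨stackBlock P S, by simp [stackBlock], by simp [stackBlock, topRule]⟩

theorem stackBlocks_injective {ks : List K} (hks : ∀ k, k ∈ ks) :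
    Function.Injective (stackBlocks ks : P × (K → List G) → _) := by
  rintro ⟨p, S⟩ ⟨p', S'⟩ h
  simp only [stackBlocks, List.cons.injEq, Sum.inl.injEq, and_true] at h
  obtain ⟨rfl, h⟩ := h
  congr 1
  funext k
  have := List.map_inj_left.1 h k (hks k)
  simp only [stackBlock, List.cons.injEq, true_and] at this
  have hi : Function.Injective (Sum.inr ∘ some : G → P ⊕ Option G) :=
    Sum.inr_injective.comp (Option.some_injective _)
  exact List.reverse_injective (List.map_injective_iff.2 hi this)

variable [DecidableEq K] {key : P → K} {nxt : P → Option G → P} {wr : P → Option G → List G}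

/-- A rule guesses a state and a top symbol. The one-letter first block forces the state, and the
last letter of the block of `key p` forces the symbol, so exactly one rule applies. -/
theorem blockStep_stackBlocks_iff {ks : List K} (hks : ∀ k, k ∈ ks) (c : P × (K → List G)) (V) :
    BlockStep {r | ∃ p g, r = stackRule key nxt wr ks p g} (stackBlocks ks c) V ↔
      V = stackBlocks ks (stackStep key nxt wr c) := by
  obtain ⟨p, S⟩ := c
  obtain ⟨w₀, hw₀, hu⟩ := stackBlock_eq_append (P := P) (S (key p))
  constructor
  · rintro ⟨_, ⟨p', g, rfl⟩, h⟩
    unfold stackRule stackBlocks at h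
    generalize hU : [Sum.inl p] = U₀ at h
    cases h with
    | @cons _ _ _ _ d w h =>
      rw [← List.nil_append [Sum.inl p]] at hU
      obtain ⟨rfl, hU'⟩ := List.append_inj' hU rfl
      simp only [List.cons.injEq, Sum.inl.injEq, and_true] at hU'
      subst hU'
      have hd := h.of_map
      have hg : g = (S (key p)).head? := by
        obtain ⟨v, -, w, h1, -⟩ : ∃ v ∈ d, ∃ w, stackBlock P (S (key p)) = w ++
            (if key p = key p then topRule P g (wr p g) else ([], [])).1 ∧ v = w ++
            (if key p = key p then topRule P g (wr p g) else ([], [])).2 := by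
          clear h
          generalize hk : key p = k at hd ⊢
          have hmem := hks k
          clear hks
          induction hd with
          | nil => simp at hmem
          | @cons k' v _ _ h1 _ ih =>
            rcases List.mem_cons.1 hmem with rfl | hmem
            · exact ⟨v, by simp, h1⟩
            · obtain ⟨v, hv, h⟩ := ih hmem
              exact ⟨v, by simp [hv], h⟩
        rw [hw₀, if_pos rfl] at h1
        have := (List.append_inj' h1 rfl).2
        simpa [topRule] using this.symm
      subst hg
      simp only [stackBlocks, stackStep, List.nil_append, List.cons.injEq, true_and]
      clear h hks
      induction hd with
      | nil => rfl
      | @cons k v _ _ h _ ih =>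
        obtain ⟨w, h1, rfl⟩ := h
        rw [ih, List.map_cons]
        congr 1
        by_cases hk : k = key p
        · subst hk
          rw [if_pos rfl] at h1 ⊢
          rw [hw₀] at h1
          rw [Function.update_self, hu, (List.append_inj' h1 rfl).1]
        · rw [if_neg hk] at h1 ⊢
          rw [Function.update_of_ne hk, h1]
  · rintro rfl
    refine ⟨_, ⟨p, (S (key p)).head?, rfl⟩, .cons [] (rewrites_map fun k _ => ?_)⟩
    by_cases hk : k = key p
    · subst hk
      rw [if_pos rfl]
      refine ⟨w₀, hw₀, ?_⟩
      simp only [stackStep, Function.update_self]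
      exact hu _
    · rw [if_neg hk]
      refine ⟨stackBlock P (S k), by simp, ?_⟩
      simp only [stackStep, Function.update_of_ne hk, List.append_nil]

theorem reach_stackBlocks_iff {ks : List K} (hks : ∀ k, k ∈ ks) (c c' : P × (K → List G)) :
    ReflTransGen (BlockStep {r | ∃ p g, r = stackRule key nxt wr ks p g})
      (stackBlocks ks c) (stackBlocks ks c') ↔ ∃ n, (stackStep key nxt wr)^[n] c = c' := by
  constructor
  · intro h
    suffices ∀ V, ReflTransGen (BlockStep {r | ∃ p g, r = stackRule key nxt wr ks p g})
        (stackBlocks ks c) V → ∃ n, V = stackBlocks ks ((stackStep key nxt wr)^[n] c) by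
      obtain ⟨n, hn⟩ := this _ h
      exact ⟨n, (stackBlocks_injective hks hn).symm⟩
    intro V hV
    induction hV with
    | refl => exact ⟨0, rfl⟩
    | tail _ h ih =>
      obtain ⟨n, rfl⟩ := ih
      refine ⟨n + 1, ?_⟩
      rw [Function.iterate_succ_apply']
      exact (blockStep_stackBlocks_iff hks _ _).1 h
  · rintro ⟨n, rfl⟩
    induction n with
    | zero => exact .refl
    | succ n ih =>
      rw [Function.iterate_succ_apply']
      exact ih.tail ((blockStep_stackBlocks_iff hks _ _).2 rfl)

end StackMachines

/-! ### From `TM2` machines to stack machines -/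

section TM2
open Turing TM2.Stmt StateTransition

variable {K G Λ σ : Type}

/-- The stack used by the first instruction of a statement. -/
def stmtKey [Inhabited K] : Option (TM2.Stmt (fun _ : K => G) Λ σ) × σ → K
  | (some (push k _ _), _) => k
  | (some (peek k _ _), _) => k
  | (some (pop k _ _), _) => k
  | _ => default

/-- The state after executing the first instruction of a statement. -/
def stmtNext (M : Λ → TM2.Stmt (fun _ : K => G) Λ σ) :
    Option (TM2.Stmt (fun _ : K => G) Λ σ) × σ → Option G →
      Option (TM2.Stmt (fun _ : K => G) Λ σ) × σ
  | (some (push _ _ q), v), _ => (some q, v)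
  | (some (peek _ f q), v), g => (some q, f v g)
  | (some (pop _ f q), v), g => (some q, f v g)
  | (some (load a q), v), _ => (some q, a v)
  | (some (branch f q₁ q₂), v), _ => (some (cond (f v) q₁ q₂), v)
  | (some (goto l), v), _ => (some (M (l v)), v)
  | (some halt, v), _ => (none, v)
  | (none, v), _ => (none, v)

/-- The word replacing the top symbol when executing the first instruction of a statement. -/
def stmtWrite : Option (TM2.Stmt (fun _ : K => G) Λ σ) × σ → Option G → List G
  | (some (push _ f _), v), g => f v :: g.toList
  | (some (pop _ _ _), _), _ => []
  | _, g => g.toList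

/-- A configuration of a TM2 machine, with the label replaced by its statement. -/
def stmtCfg (M : Λ → TM2.Stmt (fun _ : K => G) Λ σ) (c : TM2.Cfg (fun _ : K => G) Λ σ) :
    (Option (TM2.Stmt (fun _ : K => G) Λ σ) × σ) × (K → List G) :=
  ((c.l.map M, c.var), c.stk)

theorem head?_toList_append_tail (l : List G) : l.head?.toList ++ l.tail = l := by
  cases l <;> rfl

variable (M : Λ → TM2.Stmt (fun _ : K => G) Λ σ)

/-- The states that occur when a machine supported by `T` is executed. -/
abbrev StmtState (T : Finset Λ) : Type :=
  {p : Option (TM2.Stmt (fun _ : K => G) Λ σ) × σ // p.1 ∈ TM2.stmts M T}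

theorem finite_stmtState [Finite σ] (T : Finset Λ) : Finite (StmtState M T) := by
  have := Set.Finite.prod (TM2.stmts M T).finite_toSet (Set.finite_univ (α := σ))
  exact (this.subset fun p hp => ⟨hp, trivial⟩ : {p : Option (TM2.Stmt (fun _ : K => G) Λ σ) × σ |
    p.1 ∈ TM2.stmts M T}.Finite).to_subtype

/-- This allows a restriction to finitely many states, as a finite rule set requires. -/
theorem stmtNext_mem [Inhabited Λ] {T : Finset Λ} (hT : TM2.Supports M T)
    {p : Option (TM2.Stmt (fun _ : K => G) Λ σ) × σ} (hp : p.1 ∈ TM2.stmts M T) (g : Option G) :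
    (stmtNext M p g).1 ∈ TM2.stmts M T := by
  have hnone : none ∈ TM2.stmts M T := by simp [TM2.stmts]
  obtain ⟨_ | q, v⟩ := p
  · exact hnone
  · have hs := TM2.stmts_supportsStmt hT hp
    cases q with
    | branch f q₁ q₂ =>
      refine TM2.stmts_trans ?_ hp
      cases f v <;> simp [TM2.stmts₁, TM2.stmts₁_self]
    | goto l =>
      simp only [stmtNext, TM2.stmts, Finset.mem_insertNone, Finset.mem_biUnion]
      rintro _ ⟨⟩
      exact ⟨l v, hs v, TM2.stmts₁_self⟩
    | halt => exact hnone
    | _ => exact TM2.stmts_trans (by simp [TM2.stmts₁, TM2.stmts₁_self]) hp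

variable [Inhabited K] [DecidableEq K]

theorem exists_iterate_stepAux (q : TM2.Stmt (fun _ : K => G) Λ σ) (v : σ) (S : K → List G) :
    ∃ n, (stackStep stmtKey (stmtNext M) stmtWrite)^[n] ((some q, v), S) =
      stmtCfg M (TM2.stepAux q v S) := by
  suffices h : ∀ c' c'', stackStep stmtKey (stmtNext M) stmtWrite ((some q, v), S) = c' →
      (∃ n, (stackStep stmtKey (stmtNext M) stmtWrite)^[n] c' = c'') →
      ∃ n, (stackStep stmtKey (stmtNext M) stmtWrite)^[n] ((some q, v), S) = c'' by
    induction q generalizing v S with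
    | push k f q ih =>
      exact h _ _ (by simp [stackStep, stmtKey, stmtNext, stmtWrite, head?_toList_append_tail])
        (ih _ _ (fun _ _ h ⟨n, hn⟩ => ⟨n + 1, by rw [Function.iterate_succ_apply, h, hn]⟩))
    | peek k f q ih =>
      exact h _ _ (by simp [stackStep, stmtKey, stmtNext, stmtWrite, head?_toList_append_tail])
        (ih _ _ (fun _ _ h ⟨n, hn⟩ => ⟨n + 1, by rw [Function.iterate_succ_apply, h, hn]⟩))
    | pop k f q ih =>
      exact h _ _ (by simp [stackStep, stmtKey, stmtNext, stmtWrite])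
        (ih _ _ (fun _ _ h ⟨n, hn⟩ => ⟨n + 1, by rw [Function.iterate_succ_apply, h, hn]⟩))
    | load a q ih =>
      exact h _ _ (by simp [stackStep, stmtKey, stmtNext, stmtWrite, head?_toList_append_tail])
        (ih _ _ (fun _ _ h ⟨n, hn⟩ => ⟨n + 1, by rw [Function.iterate_succ_apply, h, hn]⟩))
    | branch f q₁ q₂ ih₁ ih₂ =>
      refine h _ _ (by simp [stackStep, stmtKey, stmtNext, stmtWrite,
        head?_toList_append_tail]; rfl) ?_
      rw [TM2.stepAux]
      cases f v
      · exact ih₂ _ _ (fun _ _ h ⟨n, hn⟩ => ⟨n + 1, by rw [Function.iterate_succ_apply, h, hn]⟩)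
      · exact ih₁ _ _ (fun _ _ h ⟨n, hn⟩ => ⟨n + 1, by rw [Function.iterate_succ_apply, h, hn]⟩)
    | goto l =>
      exact ⟨1, by simp [stackStep, stmtKey, stmtNext, stmtWrite, head?_toList_append_tail,
        stmtCfg]⟩
    | halt =>
      exact ⟨1, by simp [stackStep, stmtKey, stmtNext, stmtWrite, head?_toList_append_tail,
        stmtCfg]⟩
  exact fun _ _ h ⟨n, hn⟩ => ⟨n + 1, by rw [Function.iterate_succ_apply, h, hn]⟩

theorem iterate_none (n : ℕ) (v : σ) (S : K → List G) :
    (stackStep stmtKey (stmtNext M) stmtWrite)^[n] ((none, v), S) = ((none, v), S) :=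
  Function.iterate_fixed
    (by simp [stackStep, stmtKey, stmtNext, stmtWrite, head?_toList_append_tail]) n

/-- Only `goto` costs a step of the `TM2` machine; all other instructions are absorbed by
`TM2.stepAux`. -/
theorem reaches_stepAux_of_iterate {v' : σ} {S' : K → List G} (n : ℕ) :
    ∀ (q : TM2.Stmt (fun _ : K => G) Λ σ) (v : σ) (S : K → List G),
    (stackStep stmtKey (stmtNext M) stmtWrite)^[n] ((some q, v), S) = ((none, v'), S') →
      Reaches (TM2.step M) (TM2.stepAux q v S) ⟨none, v', S'⟩ := by
  induction n with
  | zero => simp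
  | succ n ih =>
    intro q v S h
    rw [Function.iterate_succ_apply] at h
    cases q with
    | branch f q₁ q₂ =>
      rw [TM2.stepAux]
      simp only [stackStep, stmtKey, stmtNext, stmtWrite, head?_toList_append_tail,
        Function.update_eq_self] at h
      cases hf : f v <;> rw [hf] at h <;> exact ih _ _ _ h
    | goto l =>
      simp only [stackStep, stmtKey, stmtNext, stmtWrite, head?_toList_append_tail,
        Function.update_eq_self] at h
      exact .head rfl (ih _ _ _ h)
    | halt =>
      simp only [stackStep, stmtKey, stmtNext, stmtWrite, head?_toList_append_tail,
        Function.update_eq_self, iterate_none] at h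
      cases h
      exact .refl
    | _ =>
      simp only [stackStep, stmtKey, stmtNext, stmtWrite, head?_toList_append_tail,
        Function.update_eq_self, List.cons_append, List.nil_append] at h
      have := ih _ _ _ h
      exact this

theorem reaches_iff_iterate (c : TM2.Cfg (fun _ : K => G) Λ σ) (v' : σ) (S' : K → List G) :
    Reaches (TM2.step M) c ⟨none, v', S'⟩ ↔
      ∃ n, (stackStep stmtKey (stmtNext M) stmtWrite)^[n] (stmtCfg M c) = ((none, v'), S') := by
  constructor
  · intro h
    induction h using ReflTransGen.head_induction_on with
    | refl => exact ⟨0, rfl⟩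
    | @head c c' h _ ih =>
      obtain ⟨_ | l, v, S⟩ := c
      · cases h
      · cases h
        obtain ⟨n, hn⟩ := ih
        obtain ⟨m, hm⟩ := exists_iterate_stepAux M (M l) v S
        refine ⟨n + m, ?_⟩
        rw [Function.iterate_add_apply, ← hn, ← hm]
        rfl
  · rintro ⟨n, hn⟩
    obtain ⟨_ | l, v, S⟩ := c
    · simp only [stmtCfg, Option.map_none, iterate_none] at hn
      cases hn
      exact .refl
    · exact .head rfl (reaches_stepAux_of_iterate M n _ _ _ hn)

variable {M}

/-- Forgetting the membership proof in a state is injective and commutes with the step function. -/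
theorem reaches_iff_blockStep [Inhabited Λ] {T : Finset Λ} (hT : TM2.Supports M T) {ks : List K}
    (hks : ∀ k, k ∈ ks) (p p' : StmtState M T) (S S' : K → List G)
    (c : TM2.Cfg (fun _ : K => G) Λ σ) (hp : stmtCfg M c = (p.1, S)) (hp' : p'.1.1 = none) :
    Reaches (TM2.step M) c ⟨none, p'.1.2, S'⟩ ↔ ReflTransGen (BlockStep {r | ∃ p g,
      r = stackRule (fun p : StmtState M T => stmtKey p.1)
        (fun p g => ⟨stmtNext M p.1 g, stmtNext_mem M hT p.2 g⟩)
        (fun p g => stmtWrite p.1 g) ks p g}) (stackBlocks ks (p, S)) (stackBlocks ks (p', S')) := by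
  rw [reaches_iff_iterate, reach_stackBlocks_iff hks, hp]
  have hproj : Function.Injective (Prod.map Subtype.val id :
      StmtState M T × (K → List G) → _ × (K → List G)) :=
    Subtype.val_injective.prodMap Function.injective_id
  refine exists_congr fun n => ?_
  rw [← hproj.eq_iff]
  have hsemi : Function.Semiconj (Prod.map Subtype.val id :
      StmtState M T × (K → List G) → _ × (K → List G))
      (stackStep (fun p : StmtState M T => stmtKey p.1)
        (fun p g => ⟨stmtNext M p.1 g, stmtNext_mem M hT p.2 g⟩)
        (fun p g => stmtWrite p.1 g)) (stackStep stmtKey (stmtNext M) stmtWrite) := fun _ => rfl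
  rw [(hsemi.iterate_right n).eq]
  have : ((none, p'.1.2), S') = Prod.map Subtype.val id (p', S') := by
    simp [Prod.map, ← hp']
  rw [this]
  rfl

open PartrecToTM2 in
theorem trNat_two_pow (n : ℕ) : trNat (2 ^ n) = List.replicate n Γ'.bit0 ++ [Γ'.bit1] := by
  have key : ((2 ^ n : ℕ) : Num) = Num.pos (PosNum.bit0^[n] 1) := by
    induction n with
    | zero => rfl
    | succ n ih =>
      rw [Function.iterate_succ_apply', pow_succ, Nat.cast_mul, ih]
      rw [mul_comm]
      change (2 : Num) * _ = _
      rw [two_mul]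
      exact Num.bit0_of_bit0 _
  rw [trNat, key]
  change trPosNum _ = _
  clear key
  induction n with
  | zero => rfl
  | succ n ih => rw [Function.iterate_succ_apply', trPosNum, ih]; rfl

open PartrecToTM2 in
/-- The halting of a code on powers of two, as a reachability problem of a finite system of
blockwise suffix rewriting rules. -/
theorem exists_blockSystem (c : ToPartrec.Code) (hc : ∀ n, ∀ v ∈ c.eval [2 ^ n], v = [0]) :
    ∃ (B : Type) (_ : Finite B) (R : Set (List (List B × List B))) (m : ℕ)
      (C : ℕ → List (List B)) (D : List (List B)), R.Finite ∧ (∀ r ∈ R, r.length = m) ∧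
      (∀ n, (C n).length = m) ∧
      (∀ n, ReflTransGen (BlockStep R) (C n) D ↔ (c.eval [2 ^ n]).Dom) ∧
      ∃ (pre : List (Option B)) (z : Option B) (post : List (Option B)), ∀ n,
        blockWord (C n) = pre ++ List.replicate n z ++ post := by
  let _ : Inhabited Λ' := ⟨trNormal c Cont'.halt⟩
  have hT := tr_supports c Cont'.halt
  let T := codeSupp c Cont'.halt
  let ks : List K' := [.main, .rev, .aux, .stack]
  have hks : ∀ k, k ∈ ks := by rintro (_ | _ | _ | _) <;> simp [ks]
  have hfin := finite_stmtState tr T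
  let p : StmtState tr T := ⟨(some (tr (trNormal c Cont'.halt)), none), by
    simp only [TM2.stmts, Finset.mem_insertNone, Finset.mem_biUnion]
    rintro _ ⟨⟩
    exact ⟨_, hT.1, TM2.stmts₁_self⟩⟩
  let p' : StmtState tr T := ⟨(none, none), by simp [TM2.stmts]⟩
  refine ⟨StmtState tr T ⊕ Option Γ', inferInstance, {r | ∃ p g,
      r = stackRule (fun p : StmtState tr T => stmtKey p.1)
        (fun p g => ⟨stmtNext tr p.1 g, stmtNext_mem tr hT p.2 g⟩)
        (fun p g => stmtWrite p.1 g) ks p g}, 5,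
      fun n => stackBlocks ks (p, K'.elim (trList [2 ^ n]) [] [] []),
      stackBlocks ks (p', K'.elim (trList [0]) [] [] []), ?_, ?_, ?_, ?_, ?_⟩
  · refine (Set.finite_range fun x : StmtState tr T × Option Γ' =>
      stackRule (fun p : StmtState tr T => stmtKey p.1)
        (fun p g => ⟨stmtNext tr p.1 g, stmtNext_mem tr hT p.2 g⟩)
        (fun p g => stmtWrite p.1 g) ks x.1 x.2).subset ?_
    rintro _ ⟨p, g, rfl⟩
    exact ⟨(p, g), rfl⟩
  · rintro _ ⟨p, g, rfl⟩
    simp [stackRule, ks]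
  · intro n
    simp [stackBlocks, ks]
  · intro n
    refine (reaches_iff_blockStep hT hks p p' _ _ (init c [2 ^ n]) rfl rfl).symm.trans ?_
    -- By `hc` the only possible output is `[0]`, so halting means reaching one fixed configuration.
    have h := tr_eval c [2 ^ n]
    have h1 : Reaches (TM2.step tr) (init c [2 ^ n]) (PartrecToTM2.halt [0]) ↔
        PartrecToTM2.halt [0] ∈ eval (TM2.step tr) (init c [2 ^ n]) :=
      (and_iff_left rfl).symm.trans mem_eval.symm
    refine h1.trans ?_
    rw [h, Part.dom_iff_mem]
    constructor
    · intro h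
      obtain ⟨v, hv, -⟩ := (Part.mem_map_iff _).1 h
      exact ⟨v, hv⟩
    · rintro ⟨v, hv⟩
      obtain rfl := hc n v hv
      exact Part.mem_map _ hv
  -- Blocks list stacks from the bottom, and the least significant bit is on top: the main stack
  -- reads `cons`, `bit1`, then `n` times `bit0`.
  · refine ⟨[some (.inl p), none, some (.inr none), some (.inr (some Γ'.cons)),
      some (.inr (some Γ'.bit1))], some (.inr (some Γ'.bit0)),
      [none, some (.inr none), none, some (.inr none), none, some (.inr none), none], fun n => ?_⟩
    simp [stackBlocks, ks, blockWord, terminated, stackBlock, trNat_two_pow]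

end TM2

/-! ### Computability of the reduction -/

section Computability

theorem primrec_intCast : Primrec (Nat.cast : ℕ → ℤ) :=
  -- The encoding of ℤ sends a natural number `n` to `2 * n`.
  Primrec.encode_iff.1 ((Primrec.nat_mul.comp (Primrec.const 2) Primrec.id).of_eq fun _ => rfl)

theorem primrec_wordVal_replicate {A : Type} (code : A → ℕ) (b : ℕ) (pre : List A) (z : A)
    (post : List A) :
    Primrec fun n => wordVal code b (pre ++ List.replicate n z ++ post) := by
  have h : Primrec fun n : ℕ => (fun x => x * b + code z)^[n] (wordVal code b pre) :=
    Primrec.nat_iterate Primrec.id (Primrec.const _) (Primrec.nat_add.comp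
      (Primrec.nat_mul.comp Primrec.snd (Primrec.const b)) (Primrec.const (code z))).to₂
  refine (Primrec.nat_add.comp (Primrec.nat_mul.comp h (Primrec.const (b ^ post.length)))
    (Primrec.const (wordVal code b post))).of_eq fun n => ?_
  rw [wordVal_append]
  congr 2
  induction n with
  | zero => simp
  | succ n ih =>
    rw [Function.iterate_succ_apply', ih, List.replicate_succ', ← List.append_assoc,
      wordVal_append _ _ (pre ++ _)]
    simp [wordVal]

theorem primrec_two_pow : Primrec fun n : ℕ => 2 ^ n := by
  refine (Primrec.nat_rec₁ 1 (f := fun _ x : ℕ => 2 * x)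
    (Primrec.nat_mul.comp (Primrec.const 2) Primrec.snd).to₂).of_eq fun n => ?_
  induction n with
  | zero => rfl
  | succ n ih => rw [pow_succ, mul_comm, ← ih]

open Encodable in
/-- There is a code for a partial function with values in `{0}` whose domain, restricted to the
powers of two, is the halting set. -/
theorem exists_toPartrecCode : ∃ c : Turing.ToPartrec.Code,
    (∀ n, ∀ v ∈ c.eval [2 ^ n], v = [0]) ∧
    ∀ e : Nat.Partrec.Code, (c.eval [2 ^ encode e]).Dom ↔ (e.eval 0).Dom := by
  -- The exponent of `N` is found by search and run as a program on input 0; its result is discarded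
  -- to make the output unique.
  let g : ℕ →. ℕ := fun N => (Nat.rfind fun k => Part.some (decide (2 ^ k = N))).bind fun k =>
    ((Denumerable.ofNat Nat.Partrec.Code k).eval 0).map fun _ => 0
  have hg : Partrec g := by
    refine Partrec.bind (Partrec.rfind ?_) ?_
    · exact (Primrec.eq.decide.comp (primrec_two_pow.comp Primrec.snd)
        Primrec.fst).to_comp.partrec.to₂
    · refine Partrec.map ?_ (Computable.const 0).to₂
      exact Nat.Partrec.Code.eval_part.comp ((Computable.ofNat _).comp Computable.snd)
        (Computable.const 0)
  have hpow : ∀ n, g (2 ^ n) = ((Denumerable.ofNat Nat.Partrec.Code n).eval 0).map fun _ => 0 := by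
    intro n
    have : (Nat.rfind fun k => Part.some (decide (2 ^ k = 2 ^ n))) = Part.some n := by
      refine Part.eq_some_iff.2 (Nat.mem_rfind.2 ⟨by simp, fun {m} hm => ?_⟩)
      simp [hm.ne]
    simp only [g, this, Part.bind_some]
  obtain ⟨c, hc⟩ := Turing.ToPartrec.Code.exists_code (Nat.Partrec'.part_iff₁.2 hg)
  have hc' : ∀ N, c.eval [N] = pure <$> g N := fun N => hc ⟨[N], rfl⟩
  refine ⟨c, fun n v hv => ?_, fun e => ?_⟩
  · rw [hc', hpow] at hv
    obtain ⟨x, hx, rfl⟩ := (Part.mem_map_iff _).1 hv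
    obtain ⟨y, -, rfl⟩ := (Part.mem_map_iff _).1 hx
    rfl
  · rw [hc', hpow, Denumerable.ofNat_encode]
    rfl

theorem exists_digits (A : Type) [Finite A] : ∃ (code : A → ℕ) (b : ℕ),
    Function.Injective code ∧ (∀ a, 0 < code a) ∧ ∀ a, code a < b := by
  obtain ⟨n, ⟨e⟩⟩ := Finite.exists_equiv_fin A
  refine ⟨fun a => e a + 1, n + 1, fun a a' h => ?_, fun a => by simp, fun a => by simp⟩
  exact e.injective (Fin.ext (by simpa using h))

end Computability

/-! ### Reduction from the halting problem -/

theorem mainTheorem7 (d : ℕ) (hd : 4 ≤ d) : ¬ CoverabilityDecidable (diagonalMatrices d) := by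
  rintro ⟨f, hf, hspec⟩
  obtain ⟨c, hc, hdom⟩ := exists_toPartrecCode
  obtain ⟨B, _, R, m, C, D, hR, hm, hC, hreach, pre, z, post, hword⟩ := exists_blockSystem c hc
  obtain ⟨code, b, hinj, hpos, hlt⟩ := exists_digits (Option B)
  obtain ⟨M, hM, qs, qt, hcov⟩ := exists_machineCode (finite_wordEdge d code b
    (finite_ruleEdge hR D) (some []) none) (.inr false) (.inr true)
  -- These values carry no signs, since the first edge of the machine sets them.
  let v : ℕ → Fin d → ℤ := fun n i => (wordVal code b (regWord i [] (blockWord (C n))) : ℤ)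
  have hv : Primrec v := by
    refine Primrec.fin_curry.2 (Primrec₂.swap (Primrec.fin_curry₁.2 fun i => ?_))
    by_cases hi : (i : ℕ) < 2
    · simpa [v, regWord, hi] using Primrec.const _
    · simpa [v, regWord, hi, hword] using
        primrec_intCast.comp (primrec_wordVal_replicate code b pre z post)
  have hinput : Computable fun e : Nat.Partrec.Code =>
      ((M, ((qs : ℕ), v (Encodable.encode e)), ((qt : ℕ), 0)) : CoverabilityInput d) :=
    (Computable.const M).pair (((Computable.const _).pair
      (hv.to_comp.comp Computable.encode)).pair (Computable.const _))
  refine ComputablePred.halting_problem 0 (ComputablePred.computable_iff.2 ?_)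
  have hans : ∀ e : Nat.Partrec.Code, ∃ a ∈ f (M, ((qs : ℕ), v (Encodable.encode e)),
      ((qt : ℕ), 0)), (a = true ↔ (e.eval 0).Dom) := by
    intro e
    obtain ⟨a, ha, h⟩ := hspec M hM qs qt (v (Encodable.encode e)) 0
    refine ⟨a, ha, h.trans ((hcov _ _).trans ?_)⟩
    rw [← hdom, ← hreach, ← ruleSystem_reach_iff hm (hC _),
      ← wordSystem_reach_iff hinj hpos hlt hd]
    rfl
  -- On these instances the partial algorithm always answers, so its composition with the computable
  -- input map is total.
  choose a ha ha' using hans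
  refine ⟨a, ?_, ?_⟩
  · exact (hf.comp hinput).of_eq fun e => Part.eq_some_iff.2 (ha e)
  · funext e
    exact propext (ha' e).symm
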